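/- Let $G=\mathbb R\ltimes\mathbb R$ be the affine group with law $(a,b)(a',b')=(a+a',b+e^{-a}b')$ and left Haar measure $e^a\,da\,db$, and let $\mathcal A=C_c^\infty(G)$ be the algebra of smooth compactly supported complex functions $f(a,b)$ on $G$. For $f\in\mathcal A$ put $$\tilde f(a,\beta)=e^a\int_{\mathbb R}f(a,b)\,e^{ib\beta}\,db .$$ Let $\delta_2 f=\frac{d}{du}\big|_{u=0}\eta_u(f)$ with $(\eta_u f)(a,b)=e^{-u}f(a,e^{-u}b)$, i.e. $(\delta_2f)(a,b)=-f(a,b)-b\,\partial_bf(a,b)$, equivalently $\widetilde{\delta_2f}(a,\beta)=\beta\,\partial_\beta\tilde f(a,\beta)$. Let $\tau$ be the trace $\tau=\frac1{2\pi}\,\tau_{\mathbb R}\circ\mathcal F\circ\rho$ on $\mathcal A$, where $\rho(f)(a)=\tilde f(a,0)$, $\mathcal F(g)(\alpha)=\int_{\mathbb R} g(a)e^{ia\alpha}\,da$ and $\tau_{\mathbb R}(\phi)=\int_{\mathbb R}\phi(\alpha)\,d\alpha$. Let $\pi_\pm$ be the representations of $\mathcal A$ on $L^2(\mathbb R,ds)$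 obtained by integrating the unitary representations $(\pi_\pm(a,b)\phi)(s)=e^{\pm ibe^{-s}}\phi(s+a)$ of $G$: $\pi_\pm(f)\phi=\int_G f(a,b)\,\pi_\pm(a,b)\phi\;e^a\,da\,db$. Then for every $f\in\mathcal A$ the operators $\pi_+(\delta_2f)$ and $\pi_-(\delta_2f)$ are trace class, the integral over $\alpha$ defining $\tau(f)$ converges absolutely, and, with $\mathrm{tr}_\pm(g)=\mathrm{Tr}(\pi_\pm(g))$, $$\tau(f)=-\,\mathrm{tr}_-(\delta_2f)=-\,\mathrm{tr}_+(\delta_2f).$$ Moreover, with absolutely convergent integrals, $$\tau(f)=\int_{-\infty}^0\frac{1}{\beta}\,\widetilde{\delta_2f}(0,\beta)\,d\beta=-\int_0^{\infty}\frac{1}{\beta}\,\widetilde{\delta_2f}(0,\beta)\,d\beta .$$ -/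

import Mathlib

open MeasureTheory Complex
open scoped ENNReal ContDiff InnerProductSpace Distributions

noncomputable section

namespace AffineGroup

/-! ## Trace-class operators -/

section TraceClass

universe u

variable {H : Type u} [NormedAddCommGroup H] [InnerProductSpace ℂ H] [CompleteSpace H]

/-- `T` is trace class: `∑ᵢ ⟨eᵢ, |T| eᵢ⟩ < ∞` for every Hilbert basis `e`,
where `|T| = (T* T)^{1/2}`. -/
def IsTraceClass (T : H →L[ℂ] H) : Prop :=
  ∀ (ι : Type u) (e : HilbertBasis ι ℂ H),
    Summable fun i => (⟪e i, CFC.abs T (e i)⟫_ℂ).re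

/-- `z` is the trace of `T`: the sum `∑ᵢ ⟨eᵢ, T eᵢ⟩` converges (unconditionally) to `z` for every
Hilbert basis `e`. -/
def HasTrace (T : H →L[ℂ] H) (z : ℂ) : Prop :=
  ∀ (ι : Type u) (e : HilbertBasis ι ℂ H), HasSum (fun i => ⟪e i, T (e i)⟫_ℂ) z

end TraceClass

/-! ## The smooth algebra of the affine group

The group `G` is `ℝ × ℝ` with the law `(a, b)(a', b') = (a + a', b + e^{-a} b')` and the left Haar
measure `e^a da db`. -/

/-- Smooth compactly supported complex functions `f(a, b)` on `G`. -/
abbrev SmoothAlgebra : Type := 𝓓((⊤ : TopologicalSpace.Opens (ℝ × ℝ)), ℂ)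

/-- The function `f` in the variables `(a, β)`: `e^a ∫ f(a, b) e^{i b β} db`. -/
def tilde (f : SmoothAlgebra) (a β : ℝ) : ℂ :=
  Real.exp a * ∫ b : ℝ, f (a, b) * cexp (I * b * β)

/-- The automorphism `η_u` in the variables `(a, b)`: `(η_u f)(a, b) = e^{-u} f(a, e^{-u} b)`.
In the variables `(a, β)` it is the dilation `β ↦ e^u β`. -/
def eta (u : ℝ) (f : ℝ × ℝ → ℂ) (p : ℝ × ℝ) : ℂ :=
  Real.exp (-u) * f (p.1, Real.exp (-u) * p.2)

/-- The derivation `δ₂ f = d/du η_u(f)` at `u = 0`, that is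
`(δ₂ f)(a, b) = - f(a, b) - b (∂_b f)(a, b)`. -/
def delta₂ (f : SmoothAlgebra) : SmoothAlgebra where
  toFun p := -f p - (p.2 : ℂ) * fderiv ℝ f p (0, 1)
  contDiff' := by
    have hf : ContDiff ℝ ∞ f := f.contDiff
    have h1 : ContDiff ℝ ∞ (fun p : ℝ × ℝ => fderiv ℝ f p (0, 1)) :=
      (hf.fderiv_right (m := ∞) le_rfl).clm_apply contDiff_const
    have h2 : ContDiff ℝ ∞ (fun p : ℝ × ℝ => (p.2 : ℂ)) :=
      ofRealCLM.contDiff.comp contDiff_snd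
    exact hf.neg.sub (h2.mul h1)
  hasCompactSupport' := by
    have hf : HasCompactSupport f := f.hasCompactSupport
    have h1 : HasCompactSupport (fun p : ℝ × ℝ => fderiv ℝ f p (0, 1)) :=
      hf.fderiv_apply (𝕜 := ℝ) (0, 1)
    exact hf.neg.sub h1.mul_left
  tsupport_subset' := fun _ _ => trivial

theorem hasDerivAt_eta (f : SmoothAlgebra) (p : ℝ × ℝ) :
    HasDerivAt (fun u : ℝ => eta u f p) (delta₂ f p) 0 := by
  have he : HasDerivAt (fun u : ℝ => Real.exp (-u)) (-1) 0 := by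
    simpa using (hasDerivAt_neg (0 : ℝ)).exp
  have hc : HasDerivAt (fun u : ℝ => ((p.1, Real.exp (-u) * p.2) : ℝ × ℝ)) (0, -1 * p.2) 0 :=
    (hasDerivAt_const (0 : ℝ) p.1).prodMk (he.mul_const p.2)
  have hd : HasFDerivAt f (fderiv ℝ f p) (p.1, Real.exp (-0) * p.2) := by
    have : ((p.1, Real.exp (-0) * p.2) : ℝ × ℝ) = p := by simp
    rw [this]
    exact (f.contDiff.differentiable (by simp) p).hasFDerivAt
  have h := he.ofReal_comp.mul (hd.comp_hasDerivAt (0 : ℝ) hc)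
  refine h.congr_deriv ?_
  have e2 : ((0, -1 * p.2) : ℝ × ℝ) = (-p.2) • ((0, 1) : ℝ × ℝ) := by ext <;> simp
  have e3 : ((p.1, Real.exp (-0) * p.2) : ℝ × ℝ) = p := by simp
  change _ = -f p - (p.2 : ℂ) * fderiv ℝ f p (0, 1)
  rw [e2, map_smul]
  simp only [Function.comp, e3]
  simp
  ring

/-! ## The trace `τ`

`τ = (1 / 2π) τ_ℝ ∘ 𝓕 ∘ ρ`, where `ρ` is the quotient map onto the group algebra of `ℝ`, `𝓕` the
Fourier transform of the latter and `τ_ℝ` integration over `ℝ`. -/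

/-- The quotient map `ρ`: in the variables `(a, β)` it is evaluation at `β = 0`. -/
def rho (f : SmoothAlgebra) (a : ℝ) : ℂ := tilde f a 0

/-- The Fourier transform `(𝓕 g)(α) = ∫ g(a) e^{i a α} da`. -/
def fourierA (g : ℝ → ℂ) (α : ℝ) : ℂ := ∫ a : ℝ, g a * cexp (I * a * α)

/-- The trace `τ(f) = (1 / 2π) ∫ 𝓕(ρ(f))(α) dα` on the smooth algebra. -/
def tau (f : SmoothAlgebra) : ℂ :=
  (1 / (2 * Real.pi)) * ∫ α : ℝ, fourierA (rho f) α

/-! ## The representations `π_ν` on `L²(ℝ)` -/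

/-- The Hilbert space `L²(ℝ, ds)`. -/
abbrev L2R : Type := Lp ℂ 2 (volume : Measure ℝ)

/-- The phase `s ↦ e^{i ν b e^{-s}}`. -/
def phase (ν b s : ℝ) : ℂ := cexp (I * (ν * b * Real.exp (-s) : ℝ))

theorem norm_phase (ν b s : ℝ) : ‖phase ν b s‖ = 1 := by
  rw [phase, mul_comm, Complex.norm_exp_ofReal_mul_I]

theorem continuous_phase (ν b : ℝ) : Continuous (phase ν b) := by
  unfold phase; fun_prop

theorem memLp_phase_mul (ν b : ℝ) (φ : L2R) :
    MemLp (fun s => phase ν b s * φ s) 2 volume :=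
  (Lp.memLp φ).of_le ((continuous_phase ν b).aestronglyMeasurable.mul
    (Lp.aestronglyMeasurable φ)) (.of_forall fun s => by simp [norm_phase])

/-- Multiplication by the phase, as an isometry of `L²(ℝ)`. -/
def mulPhase (ν b : ℝ) : L2R →ₗᵢ[ℂ] L2R where
  toFun φ := (memLp_phase_mul ν b φ).toLp _
  map_add' φ ψ := by
    rw [← MemLp.toLp_add]
    refine MemLp.toLp_congr _ _ ?_
    filter_upwards [Lp.coeFn_add φ ψ] with s hs
    rw [hs]
    exact mul_add _ _ _
  map_smul' c φ := by
    rw [RingHom.id_apply, ← MemLp.toLp_const_smul]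
    refine MemLp.toLp_congr _ _ ?_
    filter_upwards [Lp.coeFn_smul c φ] with s hs
    rw [hs]
    exact mul_left_comm _ _ _
  norm_map' φ := by
    change ‖(memLp_phase_mul ν b φ).toLp _‖ = ‖φ‖
    rw [Lp.norm_toLp, Lp.norm_def]
    congr 1
    exact eLpNorm_congr_norm_ae (.of_forall fun s => by simp [norm_phase])

/-- The translation `(T_a φ)(s) = φ(s + a)`, as an isometry of `L²(ℝ)`. -/
def translation (a : ℝ) : L2R →ₗᵢ[ℂ] L2R :=
  Lp.compMeasurePreservingₗᵢ ℂ (fun s => s + a) (measurePreserving_add_right volume a)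

/-- The unitary representation `(π_ν(a, b) φ)(s) = e^{i ν b e^{-s}} φ(s + a)` of `G`. -/
def groupRep (ν : ℝ) (p : ℝ × ℝ) : L2R →ₗᵢ[ℂ] L2R :=
  (mulPhase ν p.2).comp (translation p.1)

theorem coeFn_groupRep (ν : ℝ) (p : ℝ × ℝ) (φ : L2R) :
    groupRep ν p φ =ᵐ[volume] fun s => phase ν p.2 s * φ (s + p.1) := by
  have h1 : groupRep ν p φ =ᵐ[volume] fun s => phase ν p.2 s * translation p.1 φ s :=
    (memLp_phase_mul ν p.2 (translation p.1 φ)).coeFn_toLp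
  have h2 : translation p.1 φ =ᵐ[volume] fun s => φ (s + p.1) :=
    Lp.coeFn_compMeasurePreserving φ (measurePreserving_add_right volume p.1)
  filter_upwards [h1, h2] with s hs1 hs2
  rw [hs1, hs2]

theorem continuous_translation (φ : L2R) : Continuous fun a => translation a φ := by
  have hg : Continuous fun a : ℝ => (⟨fun s => s + a, by fun_prop⟩ : C(ℝ, ℝ)) :=
    ContinuousMap.continuous_of_continuous_uncurry _ (by
      change Continuous fun q : ℝ × ℝ => q.2 + q.1
      fun_prop)
  exact (continuous_const (y := φ)).compMeasurePreservingLp hg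
    (fun a => measurePreserving_add_right volume a) (by simp)

theorem continuous_mulPhase (ν : ℝ) (φ : L2R) : Continuous fun b => mulPhase ν b φ := by
  have hw : ∀ ψ : L2R, Continuous fun b => ⟪ψ, mulPhase ν b φ⟫_ℂ := by
    intro ψ
    have he : ∀ b, ⟪ψ, mulPhase ν b φ⟫_ℂ = ∫ s, phase ν b s * ⟪ψ s, φ s⟫_ℂ := by
      intro b
      rw [L2.inner_def]
      refine integral_congr_ae ?_
      filter_upwards [(memLp_phase_mul ν b φ).coeFn_toLp] with s hs
      change ⟪ψ s, ((memLp_phase_mul ν b φ).toLp _ : L2R) s⟫_ℂ = _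
      rw [hs, ← smul_eq_mul, inner_smul_right]
    simp_rw [he]
    have hi : Integrable (fun s => ⟪ψ s, φ s⟫_ℂ) volume := L2.integrable_inner ψ φ
    refine continuous_of_dominated (bound := fun s => ‖⟪ψ s, φ s⟫_ℂ‖) (fun b => ?_)
      (fun b => .of_forall fun s => ?_) hi.norm (.of_forall fun s => ?_)
    · exact (continuous_phase ν b).aestronglyMeasurable.mul hi.aestronglyMeasurable
    · rw [norm_mul, norm_phase, one_mul]
    · unfold phase; fun_prop
  rw [continuous_iff_continuousAt]
  intro b₀
  rw [ContinuousAt, tendsto_iff_norm_sub_tendsto_zero]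
  have hsq : ∀ b, ‖mulPhase ν b φ - mulPhase ν b₀ φ‖ =
      √(2 * ‖φ‖ ^ 2 - 2 * (⟪mulPhase ν b₀ φ, mulPhase ν b φ⟫_ℂ).re) := by
    intro b
    rw [← Real.sqrt_sq (norm_nonneg (mulPhase ν b φ - mulPhase ν b₀ φ)), norm_sub_rev,
      @norm_sub_sq ℂ, LinearIsometry.norm_map, LinearIsometry.norm_map]
    congr 1
    change _ - 2 * (⟪mulPhase ν b₀ φ, mulPhase ν b φ⟫_ℂ).re + _ = _
    ring
  simp_rw [hsq]
  have hc : Continuous fun b =>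
      √(2 * ‖φ‖ ^ 2 - 2 * (⟪mulPhase ν b₀ φ, mulPhase ν b φ⟫_ℂ).re) :=
    (continuous_const.sub (continuous_const.mul (continuous_re.comp (hw _)))).sqrt
  have h0 : √(2 * ‖φ‖ ^ 2 - 2 * (⟪mulPhase ν b₀ φ, mulPhase ν b₀ φ⟫_ℂ).re) = 0 := by
    rw [← hsq, sub_self, norm_zero]
  simpa only [h0] using hc.tendsto b₀

theorem continuous_groupRep (ν : ℝ) (φ : L2R) : Continuous fun p => groupRep ν p φ := by
  rw [continuous_iff_continuousAt]
  intro p₀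
  rw [ContinuousAt, tendsto_iff_norm_sub_tendsto_zero]
  have h1 : Continuous fun p : ℝ × ℝ => ‖translation p.1 φ - translation p₀.1 φ‖ +
      ‖mulPhase ν p.2 (translation p₀.1 φ) - mulPhase ν p₀.2 (translation p₀.1 φ)‖ :=
    ((((continuous_translation φ).comp continuous_fst).sub continuous_const).norm).add
      ((((continuous_mulPhase ν _).comp continuous_snd).sub continuous_const).norm)
  refine squeeze_zero (fun p => norm_nonneg _) (fun p => ?_)
    (by simpa only [sub_self, norm_zero, add_zero] using h1.tendsto p₀)
  change ‖mulPhase ν p.2 (translation p.1 φ) - mulPhase ν p₀.2 (translation p₀.1 φ)‖ ≤ _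
  have h2 : ‖mulPhase ν p.2 (translation p.1 φ) - mulPhase ν p.2 (translation p₀.1 φ)‖ =
      ‖translation p.1 φ - translation p₀.1 φ‖ := by
    rw [← map_sub, LinearIsometry.norm_map]
  rw [← h2]
  exact norm_sub_le_norm_sub_add_norm_sub _ _ _

/-- The density `e^a f(a, b)` of `f` with respect to the left Haar measure. -/
def haarDensity (f : SmoothAlgebra) (p : ℝ × ℝ) : ℂ := Real.exp p.1 * f p

theorem continuous_haarDensity (f : SmoothAlgebra) : Continuous (haarDensity f) := by
  have : Continuous f := f.continuous
  unfold haarDensity; fun_prop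

theorem hasCompactSupport_haarDensity (f : SmoothAlgebra) :
    HasCompactSupport (haarDensity f) := f.hasCompactSupport.mul_left

theorem integrable_haarDensity_smul (ν : ℝ) (f : SmoothAlgebra) (φ : L2R) :
    Integrable (fun p : ℝ × ℝ => haarDensity f p • groupRep ν p φ) :=
  ((continuous_haarDensity f).smul (continuous_groupRep ν φ)).integrable_of_hasCompactSupport
    (hasCompactSupport_haarDensity f).smul_right

/-- The integrated representation `π_ν(f) φ = ∫_G f(a, b) π_ν(a, b) φ e^a da db`
(Bochner integral in `L²(ℝ)`), a bounded operator on `L²(ℝ)`. -/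
def rep (ν : ℝ) (f : SmoothAlgebra) : L2R →L[ℂ] L2R :=
  LinearMap.mkContinuous
    { toFun := fun φ => ∫ p : ℝ × ℝ, haarDensity f p • groupRep ν p φ
      map_add' := fun φ ψ => by
        rw [← integral_add (integrable_haarDensity_smul ν f φ)
          (integrable_haarDensity_smul ν f ψ)]
        simp only [map_add, smul_add]
      map_smul' := fun c φ => by
        rw [RingHom.id_apply, ← integral_smul]
        simp only [map_smul, smul_comm c] }
    (∫ p : ℝ × ℝ, ‖haarDensity f p‖)
    (fun φ => by
      refine (norm_integral_le_integral_norm _).trans (le_of_eq ?_)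
      rw [← integral_mul_const]
      simp only [norm_smul, LinearIsometry.norm_map])

/-- The representation `π_+`. -/
abbrev repPlus (f : SmoothAlgebra) : L2R →L[ℂ] L2R := rep 1 f

/-- The representation `π_-`. -/
abbrev repMinus (f : SmoothAlgebra) : L2R →L[ℂ] L2R := rep (-1) f

end AffineGroup

end

/-! Put `h(a, b) = -b e^a f(a, b)` (`momentDensity`), and let `ĥ` be its Fourier transform in `b`.
Since `∂_b h = e^a δ₂ f`, integration by parts gives `tilde (δ₂ f)(a, β) = -iβ ĥ(a, β)`, while
differentiation under the integral gives `∂_β tilde f(0, β) = -i ĥ(0, β)`. So `β⁻¹ tilde (δ₂ f)(0,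
β)` is the derivative of `tilde f(0, ·)`, an integrable function vanishing at both infinities; its
integral over either half-line is `± tilde f(0, 0)`. Fourier inversion gives `τ(f) = tilde f(0, 0)`
(`tau_eq_tilde`).

By `inner_rep`, `π_ν(δ₂ f)` has kernel `K(s, t) = tilde (δ₂ f)(t - s, ν e^{-s})`. On the diagonal
the substitution `β = ν e^{-s}` turns `∫ K(s, s) ds` into the same half-line integral, equal to
`-tilde f(0, 0)` for both signs of `ν`.

It remains to prove the trace class property and that the trace is the diagonal integral. The
function `w(r) = e^{-r} 1_{r>0}` (`expWeight`) is the fundamental solution of `1 + d/dr`, so `K(s,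
t) = ∫ U(x, s) w(t - x) dx`, where `U(x, s)` is `(1 + ∂_a) tilde (δ₂ f)` at `(x - s, ν e^{-s})`.
This writes the operator as an integral over `x` of rank one operators `φ ↦ ⟨w(· - x), φ⟩ U(x, ·)`.
Their norms are integrable: the factor `β` gives decay as `s → +∞`, the quadratic decay of the
Fourier transform gives it as `s → -∞`, and the support confines `x - s`. Such an integral is trace
class (`isTraceClass_of_integral_inner`), and its trace is the integral of the rank one traces
(`hasTrace_of_integral_inner`), which Fubini identifies with `∫ K(s, s) ds`. -/

noncomputable section

namespace AffineGroup

/-! ### Absolutely convergent integrals of rank one operators -/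

section Nuclear

universe u

variable {H : Type u} [NormedAddCommGroup H] [InnerProductSpace ℂ H]

/-- An orthonormal family in a separable inner product space is countable. -/
theorem countable_of_orthonormal [TopologicalSpace.SeparableSpace H] {ι : Type*} {e : ι → H}
    (he : Orthonormal ℂ e) : Countable ι := by
  have hd : ∀ i j, i ≠ j → 1 ≤ dist (e i) (e j) := by
    intro i j hij
    have h := @norm_sub_sq ℂ H _ _ _ (e i) (e j)
    rw [he.2 hij, he.1 i, he.1 j] at h
    rw [dist_eq_norm]
    norm_num at h
    nlinarith [norm_nonneg (e i - e j)]
  obtain ⟨S, hSc, hSd⟩ := TopologicalSpace.exists_countable_dense H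
  have hx : ∀ i, ∃ y ∈ S, dist (e i) y < 1 / 2 := fun i =>
    hSd.exists_dist_lt (e i) (by norm_num)
  choose y hyS hy using hx
  have : Countable S := hSc.to_subtype
  -- Distinct vectors are at distance at least `1`, so no point of the dense set is within `1 / 2`
  -- of two of them.
  refine Function.Injective.countable (f := fun i => (⟨y i, hyS i⟩ : S)) ?_
  intro i j hij
  by_contra hne
  have hyy : y i = y j := congrArg Subtype.val hij
  have h1 := dist_triangle_right (e i) (e j) (y i)
  have h2 := hy i
  have h3 := hy j
  rw [← hyy] at h3
  linarith [hd i j hne]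

/-- Bessel's inequality combined with the Cauchy-Schwarz inequality. -/
theorem sum_norm_inner_mul_norm_inner_le {ι : Type*} {e : ι → H} (he : Orthonormal ℂ e)
    (S : Finset ι) (x y : H) :
    ∑ i ∈ S, ‖⟪e i, x⟫_ℂ‖ * ‖⟪y, e i⟫_ℂ‖ ≤ ‖x‖ * ‖y‖ := by
  refine le_of_sq_le_sq ?_ (by positivity)
  refine (Finset.sum_mul_sq_le_sq_mul_sq S _ _).trans ?_
  rw [mul_pow]
  gcongr
  · exact he.sum_inner_products_le x
  · simp_rw [norm_inner_symm y]
    exact he.sum_inner_products_le y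

variable {X : Type*} [MeasurableSpace X] {μ : Measure X} {U V : X → H}
  {g : X → ℝ}

/-- The integrand of a nuclear representation is integrable. -/
theorem integrable_inner_mul_inner
    (hU : ∀ ψ, AEStronglyMeasurable (fun x => ⟪ψ, U x⟫_ℂ) μ)
    (hV : ∀ φ, AEStronglyMeasurable (fun x => ⟪V x, φ⟫_ℂ) μ)
    (hg : Integrable g μ) (hUV : ∀ x, ‖U x‖ * ‖V x‖ ≤ g x) (ψ φ : H) :
    Integrable (fun x => ⟪ψ, U x⟫_ℂ * ⟪V x, φ⟫_ℂ) μ := by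
  refine (hg.mul_const (‖ψ‖ * ‖φ‖)).mono' ((hU ψ).mul (hV φ)) (.of_forall fun x => ?_)
  rw [norm_mul]
  calc ‖⟪ψ, U x⟫_ℂ‖ * ‖⟪V x, φ⟫_ℂ‖ ≤ (‖ψ‖ * ‖U x‖) * (‖V x‖ * ‖φ‖) := by
        gcongr <;> exact norm_inner_le_norm _ _
    _ = (‖U x‖ * ‖V x‖) * (‖ψ‖ * ‖φ‖) := by ring
    _ ≤ g x * (‖ψ‖ * ‖φ‖) := by gcongr; exact hUV x

variable {T : H →L[ℂ] H}

/-- The trace of an absolutely convergent integral of operators of rank one. -/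
theorem hasTrace_of_integral_inner [TopologicalSpace.SeparableSpace H]
    (hU : ∀ ψ, AEStronglyMeasurable (fun x => ⟪ψ, U x⟫_ℂ) μ)
    (hV : ∀ φ, AEStronglyMeasurable (fun x => ⟪V x, φ⟫_ℂ) μ)
    (hg : Integrable g μ) (hUV : ∀ x, ‖U x‖ * ‖V x‖ ≤ g x)
    (hT : ∀ ψ φ, ⟪ψ, T φ⟫_ℂ = ∫ x, ⟪ψ, U x⟫_ℂ * ⟪V x, φ⟫_ℂ ∂μ) :
    HasTrace T (∫ x, ⟪V x, U x⟫_ℂ ∂μ) := by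
  intro ι e
  have : Countable ι := countable_of_orthonormal e.orthonormal
  have hint : ∀ i, Integrable (fun x => ⟪e i, U x⟫_ℂ * ⟪V x, e i⟫_ℂ) μ := fun i =>
    integrable_inner_mul_inner hU hV hg hUV _ _
  have hs : Summable fun i => ∫ x, ‖⟪e i, U x⟫_ℂ * ⟪V x, e i⟫_ℂ‖ ∂μ := by
    refine summable_of_sum_le (c := ∫ x, g x ∂μ)
      (fun i => integral_nonneg fun x => norm_nonneg _) fun S => ?_
    rw [← integral_finsetSum _ fun i _ => (hint i).norm]
    refine integral_mono (integrable_finsetSum _ fun i _ => (hint i).norm) hg fun x => ?_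
    simp_rw [norm_mul]
    exact (sum_norm_inner_mul_norm_inner_le e.orthonormal S (U x) (V x)).trans (hUV x)
  have h := hasSum_integral_of_summable_integral_norm hint hs
  simp_rw [hT]
  -- Parseval: the rank one integrand has trace `⟪V x, U x⟫`.
  have h1 : ∀ x, ⟪V x, U x⟫_ℂ = ∑' i, ⟪e i, U x⟫_ℂ * ⟪V x, e i⟫_ℂ := fun x => by
    rw [← (e.hasSum_inner_mul_inner (V x) (U x)).tsum_eq]
    simp_rw [mul_comm]
  simp_rw [h1]
  exact h

variable [CompleteSpace H]

/-- For every `ε > 0` the absolute value of `T` is within `ε` of `W* T` for a contraction `W`. -/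
theorem exists_contraction_norm_abs_sub_le (T : H →L[ℂ] H) {ε : ℝ} (hε : 0 < ε) :
    ∃ W : H →L[ℂ] H, ‖W‖ ≤ 1 ∧ ‖CFC.abs T - star W * T‖ ≤ ε := by
  set P : H →L[ℂ] H := CFC.abs T with hP
  have hP0 : 0 ≤ P := CFC.abs_nonneg T
  have hPs : IsSelfAdjoint P := hP0.isSelfAdjoint
  have hsq : P * P = star T * T := CFC.abs_mul_abs T
  have hpos : ∀ x ∈ spectrum ℝ P, 0 ≤ x := fun x hx => spectrum_nonneg_of_nonneg hP0 hx
  -- Regularized inverse: `W = T (|T| + ε)⁻¹` replaces the partial isometry of the polar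
  -- decomposition. The absolute value only serves to make `r` continuous on all of `ℝ`.
  set r : ℝ → ℝ := fun x => (|x| + ε)⁻¹ with hr
  have hrc : Continuous r := by
    refine Continuous.inv₀ (by fun_prop) fun x => ?_
    positivity
  set R : H →L[ℂ] H := cfc r P with hR
  have hRs : IsSelfAdjoint R := cfc_predicate r P
  have hid : cfc (fun x : ℝ => x) P = P := cfc_id' ℝ P
  have hRP : R * P = cfc (fun x => r x * x) P := by
    rw [cfc_mul r (fun x => x) P hrc.continuousOn continuousOn_id, hid]
  have hPR : P * R = cfc (fun x => x * r x) P := by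
    rw [cfc_mul (fun x => x) r P continuousOn_id hrc.continuousOn, hid]
  have hRPP : R * P * P = cfc (fun x => r x * x * x) P := by
    rw [cfc_mul (fun x => r x * x) (fun x => x) P (by fun_prop) continuousOn_id, hid, hRP]
  have hWW : star (T * R) * (T * R) = star (P * R) * (P * R) := by
    rw [star_mul, star_mul, hPs.star_eq, mul_assoc, ← mul_assoc (star T), ← hsq]
    simp only [mul_assoc]
  refine ⟨T * R, ?_, ?_⟩
  · have h1 : ‖T * R‖ * ‖T * R‖ = ‖P * R‖ * ‖P * R‖ := by
      rw [← CStarRing.norm_star_mul_self, ← CStarRing.norm_star_mul_self, hWW]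
    have h2 : ‖P * R‖ ≤ 1 := by
      rw [hPR]
      refine norm_cfc_le zero_le_one fun x hx => ?_
      have hx0 := hpos x hx
      simp only [hr]
      rw [Real.norm_of_nonneg (by positivity), abs_of_nonneg hx0, ← div_eq_mul_inv,
        div_le_one (by positivity)]
      linarith
    nlinarith [norm_nonneg (T * R), norm_nonneg (P * R)]
  · have h1 : star (T * R) * T = R * P * P := by
      rw [star_mul, hRs.star_eq, mul_assoc, ← hsq, mul_assoc]
    rw [h1, hRPP]
    nth_rewrite 1 [← hid]
    rw [← cfc_sub (fun x : ℝ => x) (fun x => r x * x * x) P continuousOn_id (by fun_prop)]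
    refine norm_cfc_le hε.le fun x hx => ?_
    have hx0 := hpos x hx
    -- On the spectrum `|T| - W* T` is `x - x² / (x + ε)`, which lies between `0` and `ε`.
    have : x - r x * x * x = ε * (x / (x + ε)) := by
      simp only [hr, abs_of_nonneg hx0]
      have : x + ε ≠ 0 := by positivity
      field_simp
      ring
    rw [this, Real.norm_of_nonneg (by positivity)]
    have h3 : x / (x + ε) ≤ 1 := by
      rw [div_le_one (by positivity)]
      linarith
    nlinarith

/-- An operator which is an absolutely convergent integral of operators of rank one is
trace class. -/
theorem isTraceClass_of_integral_inner
    (hU : ∀ ψ, AEStronglyMeasurable (fun x => ⟪ψ, U x⟫_ℂ) μ)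
    (hV : ∀ φ, AEStronglyMeasurable (fun x => ⟪V x, φ⟫_ℂ) μ)
    (hg : Integrable g μ) (hUV : ∀ x, ‖U x‖ * ‖V x‖ ≤ g x)
    (hT : ∀ ψ φ, ⟪ψ, T φ⟫_ℂ = ∫ x, ⟪ψ, U x⟫_ℂ * ⟪V x, φ⟫_ℂ ∂μ) :
    IsTraceClass T := by
  intro ι e
  have hnn : ∀ i, 0 ≤ (⟪e i, CFC.abs T (e i)⟫_ℂ).re := fun i =>
    ((ContinuousLinearMap.nonneg_iff_isPositive _).1 (CFC.abs_nonneg T)).re_inner_nonneg_right (e i)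
  refine summable_of_sum_le (c := ∫ x, g x ∂μ) hnn fun S => ?_
  refine le_of_forall_pos_le_add fun δ hδ => ?_
  -- The errors over `S` must add up to at most `δ`; the `+ 1` covers empty `S`.
  obtain ⟨W, hW, hWT⟩ := exists_contraction_norm_abs_sub_le T
    (ε := δ / (S.card + 1)) (by positivity)
  have h1 : ∀ i, (⟪e i, CFC.abs T (e i)⟫_ℂ).re ≤
      ‖⟪e i, (star W * T) (e i)⟫_ℂ‖ + δ / (S.card + 1) := by
    intro i
    have : ⟪e i, CFC.abs T (e i)⟫_ℂ = ⟪e i, (star W * T) (e i)⟫_ℂ +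
        ⟪e i, (CFC.abs T - star W * T) (e i)⟫_ℂ := by
      rw [← inner_add_right, sub_apply, add_sub_cancel]
    refine (re_le_norm _).trans ?_
    rw [this]
    refine (norm_add_le _ _).trans ?_
    gcongr
    refine (norm_inner_le_norm _ _).trans ?_
    refine (mul_le_mul_of_nonneg_left (ContinuousLinearMap.le_opNorm _ _)
      (norm_nonneg _)).trans ?_
    rw [e.orthonormal.1 i]
    simpa using hWT
  have h2 : ∀ i, ‖⟪e i, (star W * T) (e i)⟫_ℂ‖ ≤
      ∫ x, ‖⟪W (e i), U x⟫_ℂ * ⟪V x, e i⟫_ℂ‖ ∂μ := by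
    intro i
    rw [mul_apply_eq_comp, ContinuousLinearMap.star_eq_adjoint,
      ContinuousLinearMap.adjoint_inner_right, hT]
    exact norm_integral_le_integral_norm _
  have hint : ∀ i, Integrable (fun x => ⟪W (e i), U x⟫_ℂ * ⟪V x, e i⟫_ℂ) μ := fun i =>
    integrable_inner_mul_inner hU hV hg hUV _ _
  calc ∑ i ∈ S, (⟪e i, CFC.abs T (e i)⟫_ℂ).re
      ≤ ∑ i ∈ S, (∫ x, ‖⟪W (e i), U x⟫_ℂ * ⟪V x, e i⟫_ℂ‖ ∂μ + δ / (S.card + 1)) :=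
        Finset.sum_le_sum fun i _ => (h1 i).trans (by gcongr; exact h2 i)
    _ = ∫ x, ∑ i ∈ S, ‖⟪W (e i), U x⟫_ℂ * ⟪V x, e i⟫_ℂ‖ ∂μ
          + S.card * (δ / (S.card + 1)) := by
        rw [Finset.sum_add_distrib, integral_finsetSum _ fun i _ => (hint i).norm]
        simp
    _ ≤ ∫ x, g x ∂μ + δ := by
        gcongr
        · exact integrable_finsetSum _ fun i _ => (hint i).norm
        · intro x
          refine le_trans ?_ (hUV x)
          -- `W e` need not be orthonormal, so `W` is moved onto `U x` before Bessel is applied.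
          have h3 := sum_norm_inner_mul_norm_inner_le e.orthonormal S
            (ContinuousLinearMap.adjoint W (U x)) (V x)
          simp_rw [ContinuousLinearMap.adjoint_inner_right] at h3
          simp_rw [norm_mul]
          refine h3.trans ?_
          gcongr
          refine (ContinuousLinearMap.le_opNorm _ _).trans ?_
          rw [LinearIsometryEquiv.norm_map]
          exact mul_le_of_le_one_left (norm_nonneg _) hW
        · rw [mul_div_assoc', div_le_iff₀ (by positivity)]
          nlinarith

end Nuclear

/-! ### Integral kernels on `L²(ℝ)` and the kernel of the representation -/

section Kernel

open ComplexConjugate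

instance separableSpace_L2R : TopologicalSpace.SeparableSpace L2R := by
  have : Fact ((2 : ℝ≥0∞) ≠ ⊤) := ⟨by simp⟩
  infer_instance

/-- Translation invariance removes the shift from the inner integral. It is applied with `Φ` the
squared norm of an `L²` function: products of two such functions are dominated by sums of squares.
-/
theorem integrable_mul_comp_add {X : Type*} [MeasurableSpace X] {μ : Measure X} [SFinite μ]
    {h : X → ℝ} {Φ : ℝ → ℝ} {a : X → ℝ} (hh : Integrable h μ) (hΦ : Integrable Φ)
    (hΦm : StronglyMeasurable Φ) (ha : Measurable a) :
    Integrable (fun z : X × ℝ => h z.1 * Φ (z.2 + a z.1)) (μ.prod volume) := by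
  have hm : AEStronglyMeasurable (fun z : X × ℝ => h z.1 * Φ (z.2 + a z.1)) (μ.prod volume) :=
    hh.aestronglyMeasurable.comp_fst.mul
      (hΦm.comp_measurable (measurable_snd.add (ha.comp measurable_fst))).aestronglyMeasurable
  rw [integrable_prod_iff hm]
  refine ⟨.of_forall fun x => (hΦ.comp_add_right (a x)).const_mul (h x), ?_⟩
  refine (hh.norm.mul_const (∫ s, ‖Φ s‖)).congr (.of_forall fun x => ?_)
  simp only [norm_mul]
  rw [integral_const_mul, integral_add_right_eq_self (fun s => ‖Φ s‖) (a x)]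

theorem L2R.inner_eq_integral (ψ φ : L2R) : ⟪ψ, φ⟫_ℂ = ∫ s, conj (ψ s) * φ s := by
  rw [L2.inner_def]
  simp only [RCLike.inner_apply, mul_comm]

theorem L2R.integrable_sq_norm (φ : L2R) : Integrable fun s => ‖φ s‖ ^ 2 :=
  (Lp.memLp φ).integrable_norm_pow two_ne_zero

/-- The function `e^{-r}` on the half-line `r > 0`, extended by zero. -/
def expWeight (r : ℝ) : ℂ := (Set.Ioi (0 : ℝ)).indicator (fun r => (Real.exp (-r) : ℂ)) r

theorem stronglyMeasurable_expWeight : StronglyMeasurable expWeight := by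
  have : Continuous fun r : ℝ => (Real.exp (-r) : ℂ) := by fun_prop
  exact this.stronglyMeasurable.indicator measurableSet_Ioi

theorem norm_expWeight_le_one (r : ℝ) : ‖expWeight r‖ ≤ 1 := by
  unfold expWeight
  by_cases h : r ∈ Set.Ioi (0 : ℝ)
  · rw [Set.indicator_of_mem h, Complex.norm_real, Real.norm_of_nonneg (Real.exp_pos _).le]
    exact Real.exp_le_one_iff.2 (neg_nonpos.2 (le_of_lt h))
  · rw [Set.indicator_of_notMem h]
    simp

theorem conj_expWeight (r : ℝ) : conj (expWeight r) = expWeight r := by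
  unfold expWeight
  by_cases h : r ∈ Set.Ioi (0 : ℝ)
  · rw [Set.indicator_of_mem h, conj_ofReal]
  · rw [Set.indicator_of_notMem h, map_zero]

theorem integrable_expWeight : Integrable expWeight := by
  have h : IntegrableOn (fun r : ℝ => (Real.exp (-r) : ℂ)) (Set.Ioi 0) := by
    have := exp_neg_integrableOn_Ioi 0 one_pos
    simp only [neg_mul, one_mul] at this
    exact this.ofReal
  exact (integrable_indicator_iff measurableSet_Ioi).2 h

theorem memLp_expWeight : MemLp expWeight 2 := by
  rw [memLp_two_iff_integrable_sq_norm stronglyMeasurable_expWeight.aestronglyMeasurable]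
  refine integrable_expWeight.norm.mono'
    ((stronglyMeasurable_expWeight.norm.pow 2).aestronglyMeasurable) (.of_forall fun r => ?_)
  rw [Real.norm_of_nonneg (by positivity)]
  nlinarith [norm_expWeight_le_one r, norm_nonneg (expWeight r)]

/-- The vector `t ↦ expWeight (t - x)` of `L²(ℝ)`. -/
def expVec (x : ℝ) : L2R := translation (-x) (memLp_expWeight.toLp _)

theorem coeFn_expVec (x : ℝ) : expVec x =ᵐ[volume] fun t => expWeight (t - x) := by
  have h1 : expVec x =ᵐ[volume] fun t => memLp_expWeight.toLp _ (t + -x) :=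
    Lp.coeFn_compMeasurePreserving _ (measurePreserving_add_right volume (-x))
  have h2 := (measurePreserving_add_right volume (-x)).quasiMeasurePreserving.ae_eq_comp
    memLp_expWeight.coeFn_toLp
  filter_upwards [h1, h2] with t ht1 ht2
  rw [ht1]
  exact ht2

theorem norm_expVec (x : ℝ) : ‖expVec x‖ = ‖memLp_expWeight.toLp _‖ :=
  LinearIsometry.norm_map _ _

theorem continuous_expVec : Continuous expVec :=
  (continuous_translation _).comp continuous_neg

theorem inner_expVec (x : ℝ) (φ : L2R) :
    ⟪expVec x, φ⟫_ℂ = ∫ t, expWeight (t - x) * φ t := by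
  rw [L2R.inner_eq_integral]
  refine integral_congr_ae ?_
  filter_upwards [coeFn_expVec x] with t ht
  rw [ht, conj_expWeight]

variable {U : ℝ → ℝ → ℂ} {p q : ℝ → ℝ} {K : ℝ → ℝ → ℂ} {T : L2R →L[ℂ] L2R}

theorem memLp_of_norm_le_mul (hU : StronglyMeasurable (Function.uncurry U)) (hq2 : MemLp q 2)
    (hb : ∀ x s, ‖U x s‖ ≤ p x * q s) (x : ℝ) : MemLp (U x) 2 := by
  refine (hq2.const_mul (p x)).of_le
    (hU.comp_measurable measurable_prodMk_left).aestronglyMeasurable (.of_forall fun s => ?_)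
  exact (hb x s).trans (le_abs_self _)

/-- A separated bound makes the norm of the vector `U x` integrable in `x`. -/
theorem norm_toLp_le_mul (hU : StronglyMeasurable (Function.uncurry U)) (hq2 : MemLp q 2)
    (hp0 : ∀ x, 0 ≤ p x) (hb : ∀ x s, ‖U x s‖ ≤ p x * q s) (x : ℝ) :
    ‖(memLp_of_norm_le_mul hU hq2 hb x).toLp _‖ ≤ p x * ‖hq2.toLp q‖ := by
  refine Lp.norm_le_mul_norm_of_ae_le_mul ?_
  filter_upwards [(memLp_of_norm_le_mul hU hq2 hb x).coeFn_toLp, hq2.coeFn_toLp] with s h1 h2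
  rw [h1, h2]
  exact (hb x s).trans (mul_le_mul_of_nonneg_left (le_abs_self _) (hp0 x))

theorem inner_toLp (hU : StronglyMeasurable (Function.uncurry U)) (hq2 : MemLp q 2)
    (hb : ∀ x s, ‖U x s‖ ≤ p x * q s) (x : ℝ) (ψ : L2R) :
    ⟪ψ, (memLp_of_norm_le_mul hU hq2 hb x).toLp _⟫_ℂ = ∫ s, conj (ψ s) * U x s := by
  rw [L2R.inner_eq_integral]
  refine integral_congr_ae ?_
  filter_upwards [(memLp_of_norm_le_mul hU hq2 hb x).coeFn_toLp] with s hs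
  rw [hs]

theorem stronglyMeasurable_expWeight_sub :
    StronglyMeasurable fun z : ℝ × ℝ => expWeight (z.2 - z.1) :=
  stronglyMeasurable_expWeight.comp_measurable (measurable_snd.sub measurable_fst)

/-- Applying the kernel `∫ U(x, s) expWeight (t - x) dx` to a function. -/
theorem integral_kernel_mul (hU : StronglyMeasurable (Function.uncurry U))
    (hp : Integrable p) (hb : ∀ x s, ‖U x s‖ ≤ p x * q s)
    (hK : ∀ s t, K s t = ∫ x, U x s * expWeight (t - x)) (s : ℝ) (φ : L2R) :
    ∫ t, K s t * φ t = ∫ x, U x s * ⟪expVec x, φ⟫_ℂ := by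
  have hUs : StronglyMeasurable fun x => U x s := hU.comp_measurable measurable_prodMk_right
  have hint : Integrable
      (fun z : ℝ × ℝ => U z.1 s * expWeight (z.2 - z.1) * φ z.2) (volume.prod volume) := by
    have h1 := integrable_mul_comp_add (a := fun x => -x) (hp.mul_const (q s))
      (memLp_expWeight.integrable_norm_pow two_ne_zero)
      (stronglyMeasurable_expWeight.norm.pow 2) measurable_neg
    have h2 := (hp.mul_const (q s)).mul_prod (L2R.integrable_sq_norm φ)
    refine (h1.add h2).mono' ?_ (.of_forall fun z => ?_)
    · exact (((hUs.comp_measurable measurable_fst).mul stronglyMeasurable_expWeight_sub).mul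
        ((Lp.stronglyMeasurable φ).comp_measurable measurable_snd)).aestronglyMeasurable
    · simp only [norm_mul, Pi.add_apply, ← sub_eq_add_neg]
      rw [← mul_add, mul_assoc]
      refine mul_le_mul (hb _ _) ?_ (by positivity) ((norm_nonneg _).trans (hb z.1 s))
      nlinarith [sq_nonneg (‖expWeight (z.2 - z.1)‖ - ‖φ z.2‖),
        sq_nonneg (‖expWeight (z.2 - z.1)‖ + ‖φ z.2‖)]
  calc ∫ t, K s t * φ t = ∫ t, ∫ x, U x s * expWeight (t - x) * φ t := by
        simp_rw [hK, integral_mul_const]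
    _ = ∫ x, ∫ t, U x s * expWeight (t - x) * φ t :=
        (integral_integral_swap (f := fun x t => U x s * expWeight (t - x) * φ t) hint).symm
    _ = ∫ x, U x s * ⟪expVec x, φ⟫_ℂ := by
        simp_rw [inner_expVec, mul_assoc, integral_const_mul]

/-- An integral operator on `L²(ℝ)` with kernel `∫ U(x, s) expWeight (t - x) dx`, where `U` has
integrable decay, is trace class, and its trace is the integral of the kernel over the
diagonal. -/
theorem isTraceClass_and_hasTrace_of_kernel (hU : StronglyMeasurable (Function.uncurry U))
    (hp0 : ∀ x, 0 ≤ p x) (hp : Integrable p) (hq : Integrable q) (hq2 : MemLp q 2)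
    (hb : ∀ x s, ‖U x s‖ ≤ p x * q s)
    (hK : ∀ s t, K s t = ∫ x, U x s * expWeight (t - x))
    (hT : ∀ ψ φ : L2R, ⟪ψ, T φ⟫_ℂ = ∫ s, conj (ψ s) * ∫ t, K s t * φ t) :
    IsTraceClass T ∧ HasTrace T (∫ s, K s s) := by
  set u : ℝ → L2R := fun x => (memLp_of_norm_le_mul hU hq2 hb x).toLp _ with hu
  have huψ : ∀ x ψ, ⟪ψ, u x⟫_ℂ = ∫ s, conj (ψ s) * U x s := fun x ψ =>
    inner_toLp hU hq2 hb x ψ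
  have hum : ∀ ψ : L2R, AEStronglyMeasurable fun x => ⟪ψ, u x⟫_ℂ := by
    intro ψ
    simp_rw [huψ]
    refine StronglyMeasurable.aestronglyMeasurable (StronglyMeasurable.integral_prod_right
      (f := fun x s => conj (ψ s) * U x s) ?_)
    exact (continuous_conj.comp_stronglyMeasurable
      ((Lp.stronglyMeasurable ψ).comp_measurable measurable_snd)).mul hU
  have hvm : ∀ φ : L2R, AEStronglyMeasurable fun x => ⟪expVec x, φ⟫_ℂ := fun φ =>
    (continuous_expVec.inner continuous_const).aestronglyMeasurable
  have huv : ∀ x, ‖u x‖ * ‖expVec x‖ ≤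
      p x * (‖hq2.toLp q‖ * ‖memLp_expWeight.toLp _‖) := by
    intro x
    rw [norm_expVec, ← mul_assoc]
    exact mul_le_mul_of_nonneg_right (norm_toLp_le_mul hU hq2 hp0 hb x) (norm_nonneg _)
  have hTuv : ∀ ψ φ, ⟪ψ, T φ⟫_ℂ = ∫ x, ⟪ψ, u x⟫_ℂ * ⟪expVec x, φ⟫_ℂ := by
    intro ψ φ
    have hint : Integrable (fun z : ℝ × ℝ => conj (ψ z.1) * U z.2 z.1 * ⟪expVec z.2, φ⟫_ℂ)
        (volume.prod volume) := by
      have h1 : Integrable fun s => q s * ‖ψ s‖ := hq2.integrable_mul (Lp.memLp ψ).norm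
      refine (h1.mul_prod (hp.mul_const (‖memLp_expWeight.toLp _‖ * ‖φ‖))).mono' ?_
        (.of_forall fun z => ?_)
      · exact ((continuous_conj.comp_stronglyMeasurable
          ((Lp.stronglyMeasurable ψ).comp_measurable measurable_fst)).mul
          (hU.comp_measurable measurable_swap)).aestronglyMeasurable.mul (hvm φ).comp_snd
      · rw [norm_mul, norm_mul, RCLike.norm_conj]
        calc ‖ψ z.1‖ * ‖U z.2 z.1‖ * ‖⟪expVec z.2, φ⟫_ℂ‖
            ≤ ‖ψ z.1‖ * (p z.2 * q z.1) * (‖memLp_expWeight.toLp _‖ * ‖φ‖) := by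
              gcongr
              · exact mul_nonneg (norm_nonneg _) ((norm_nonneg _).trans (hb z.2 z.1))
              · exact hb _ _
              · rw [← norm_expVec z.2]
                exact norm_inner_le_norm _ _
          _ = _ := by ring
    rw [hT]
    calc ∫ s, conj (ψ s) * ∫ t, K s t * φ t
        = ∫ s, ∫ x, conj (ψ s) * U x s * ⟪expVec x, φ⟫_ℂ := by
          simp_rw [integral_kernel_mul hU hp hb hK, mul_assoc, integral_const_mul]
      _ = ∫ x, ∫ s, conj (ψ s) * U x s * ⟪expVec x, φ⟫_ℂ :=
          integral_integral_swap (f := fun s x => conj (ψ s) * U x s * ⟪expVec x, φ⟫_ℂ) hint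
      _ = _ := by simp_rw [integral_mul_const, huψ]
  refine ⟨isTraceClass_of_integral_inner hum hvm (hp.mul_const _) huv hTuv, ?_⟩
  have h := hasTrace_of_integral_inner hum hvm (hp.mul_const _) huv hTuv
  have hint : Integrable (fun z : ℝ × ℝ => U z.1 z.2 * expWeight (z.2 - z.1))
      (volume.prod volume) := by
    refine (hp.mul_prod hq).mono' (hU.mul stronglyMeasurable_expWeight_sub).aestronglyMeasurable
      (.of_forall fun z => ?_)
    rw [norm_mul]
    exact (mul_le_of_le_one_right (norm_nonneg _) (norm_expWeight_le_one _)).trans (hb _ _)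
  convert h using 1
  simp_rw [hK]
  -- Fubini turns the diagonal integral into the integral over `x` of `⟪expVec x, u x⟫`.
  rw [← integral_integral_swap (f := fun x s => U x s * expWeight (s - x)) hint]
  refine integral_congr_ae (.of_forall fun x => ?_)
  change _ = ⟪expVec x, u x⟫_ℂ
  rw [inner_expVec]
  refine integral_congr_ae ?_
  filter_upwards [(memLp_of_norm_le_mul hU hq2 hb x).coeFn_toLp] with s hs
  rw [hs, mul_comm]

/-- The representation `π_ν(f)` is the integral operator with kernel
`tilde f (t - s) (ν e^{-s})`. -/
theorem inner_rep (ν : ℝ) (f : SmoothAlgebra) (ψ φ : L2R) :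
    ⟪ψ, rep ν f φ⟫_ℂ =
      ∫ s, conj (ψ s) * ∫ t, tilde f (t - s) (ν * Real.exp (-s)) * φ t := by
  have h0 : ⟪ψ, rep ν f φ⟫_ℂ = ∫ p : ℝ × ℝ, ∫ s,
      haarDensity f p * (conj (ψ s) * (phase ν p.2 s * φ (s + p.1))) := by
    change ⟪ψ, ∫ p : ℝ × ℝ, haarDensity f p • groupRep ν p φ⟫_ℂ = _
    rw [← integral_inner (integrable_haarDensity_smul ν f φ)]
    refine integral_congr_ae (.of_forall fun p => ?_)
    change ⟪ψ, haarDensity f p • groupRep ν p φ⟫_ℂ = _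
    rw [inner_smul_right, L2R.inner_eq_integral]
    beta_reduce
    rw [integral_const_mul]
    congr 1
    refine integral_congr_ae ?_
    filter_upwards [coeFn_groupRep ν p φ] with s hs
    rw [hs]
  have hint : Integrable (fun z : (ℝ × ℝ) × ℝ => haarDensity f z.1 *
      (conj (ψ z.2) * (phase ν z.1.2 z.2 * φ (z.2 + z.1.1)))) (volume.prod volume) := by
    have hh : Integrable fun p => ‖haarDensity f p‖ :=
      ((continuous_haarDensity f).integrable_of_hasCompactSupport
        (hasCompactSupport_haarDensity f)).norm
    have h1 := integrable_mul_comp_add (a := Prod.fst) hh (L2R.integrable_sq_norm φ)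
      ((Lp.stronglyMeasurable φ).norm.pow 2) measurable_fst
    have h2 := hh.mul_prod (L2R.integrable_sq_norm ψ)
    refine (h1.add h2).mono' ?_ (.of_forall fun z => ?_)
    · refine StronglyMeasurable.aestronglyMeasurable ?_
      refine ((continuous_haarDensity f).comp continuous_fst).stronglyMeasurable.mul
        (StronglyMeasurable.mul ?_ (StronglyMeasurable.mul ?_ ?_))
      · exact continuous_conj.comp_stronglyMeasurable
          ((Lp.stronglyMeasurable ψ).comp_measurable measurable_snd)
      · refine Continuous.stronglyMeasurable ?_
        unfold phase
        fun_prop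
      · exact (Lp.stronglyMeasurable φ).comp_measurable (by fun_prop)
    · simp only [norm_mul, norm_phase, RCLike.norm_conj, one_mul, Pi.add_apply]
      rw [← mul_add]
      refine mul_le_mul_of_nonneg_left ?_ (norm_nonneg _)
      nlinarith [sq_nonneg (‖ψ z.2‖ - ‖φ (z.2 + z.1.1)‖),
        sq_nonneg (‖ψ z.2‖ + ‖φ (z.2 + z.1.1)‖)]
  rw [h0, integral_integral_swap (f := fun (p : ℝ × ℝ) s =>
    haarDensity f p * (conj (ψ s) * (phase ν p.2 s * φ (s + p.1)))) hint]
  refine integral_congr_ae ?_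
  filter_upwards [hint.prod_left_ae] with s hs
  -- The substitution `t = s + a` matches the translation in the representation; the integral over
  -- `b` is then `tilde f`.
  rw [Measure.volume_eq_prod, integral_prod _ hs,
    ← integral_add_left_eq_self (fun t => tilde f (t - s) (ν * Real.exp (-s)) * φ t) s,
    ← integral_const_mul]
  refine integral_congr_ae (.of_forall fun a => ?_)
  simp only [add_sub_cancel_left, tilde, haarDensity]
  rw [← integral_const_mul, ← integral_mul_const, ← integral_const_mul]
  refine integral_congr_ae (.of_forall fun b => ?_)
  simp only [phase]
  push_cast
  ring_nf

end Kernel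

/-! ### Fourier transform in one variable -/

section FourierOneVariable

open FourierTransform

variable {r r' r'' : ℝ → ℂ}

theorem norm_mul_cexp (z : ℂ) (b β : ℝ) : ‖z * cexp (I * b * β)‖ = ‖z‖ := by
  have : I * b * β = ((b * β : ℝ) : ℂ) * I := by push_cast; ring
  rw [norm_mul, this, Complex.norm_exp_ofReal_mul_I, mul_one]

theorem norm_fourierA_le (r : ℝ → ℂ) (β : ℝ) : ‖fourierA r β‖ ≤ ∫ b, ‖r b‖ := by
  refine (norm_integral_le_integral_norm _).trans (le_of_eq ?_)
  simp_rw [norm_mul_cexp]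

theorem hasCompactSupport_of_hasDerivAt (hr : HasCompactSupport r)
    (hd : ∀ b, HasDerivAt r (r' b) b) : HasCompactSupport r' := by
  have : r' = deriv r := funext fun b => (hd b).deriv.symm
  rw [this]
  exact hr.deriv

/-- The Fourier transform of a derivative. -/
theorem fourierA_of_hasDerivAt (hr : HasCompactSupport r)
    (hd : ∀ b, HasDerivAt r (r' b) b) (hr' : Continuous r') (β : ℝ) :
    fourierA r' β = -(I * β) * fourierA r β := by
  have hrc : Continuous r := continuous_iff_continuousAt.2 fun b => (hd b).continuousAt
  have he : ∀ b : ℝ, HasDerivAt (fun b : ℝ => cexp (I * b * β)) (cexp (I * b * β) * (I * β)) b := by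
    intro b
    have h := ((ofRealCLM.hasDerivAt (x := b)).const_mul I).mul_const (β : ℂ)
    simpa using h.cexp
  have hec : Continuous fun b : ℝ => cexp (I * b * β) := by fun_prop
  have i1 : Integrable fun b : ℝ => r' b * cexp (I * b * β) :=
    (hr'.mul hec).integrable_of_hasCompactSupport (hasCompactSupport_of_hasDerivAt hr hd).mul_right
  have i2 : Integrable fun b : ℝ => r b * cexp (I * b * β) :=
    (hrc.mul hec).integrable_of_hasCompactSupport hr.mul_right
  have i3 : Integrable fun b : ℝ => r b * (cexp (I * b * β) * (I * β)) := by
    simpa only [mul_assoc] using i2.mul_const (I * β)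
  have h := integral_eq_zero_of_hasDerivAt_of_integrable (fun b => (hd b).mul (he b))
    (i1.add i3) i2
  rw [integral_add i1 i3] at h
  simp_rw [← mul_assoc (r _), integral_mul_const] at h
  unfold fourierA
  linear_combination h

/-- Quadratic decay of the Fourier transform. -/
theorem norm_fourierA_mul_le (hr : HasCompactSupport r)
    (hd : ∀ b, HasDerivAt r (r' b) b) (hd' : ∀ b, HasDerivAt r' (r'' b) b)
    (hr'' : Continuous r'') (β : ℝ) :
    ‖fourierA r β‖ * (1 + β ^ 2) ≤ (∫ b, ‖r b‖) + ∫ b, ‖r'' b‖ := by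
  have hr' : Continuous r' := continuous_iff_continuousAt.2 fun b => (hd' b).continuousAt
  have h2 : fourierA r'' β = -(β : ℂ) ^ 2 * fourierA r β := by
    rw [fourierA_of_hasDerivAt (hasCompactSupport_of_hasDerivAt hr hd) hd' hr'',
      fourierA_of_hasDerivAt hr hd hr']
    linear_combination (β : ℂ) ^ 2 * fourierA r β * I_sq
  have h3 := norm_fourierA_le r'' β
  rw [h2, norm_mul, norm_neg, norm_pow, Complex.norm_real, Real.norm_eq_abs, sq_abs] at h3
  linarith [norm_fourierA_le r β]

/-- The Fourier transform of a compactly supported function is differentiable. -/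
theorem hasDerivAt_fourierA (hr : HasCompactSupport r) (hc : Continuous r) (β : ℝ) :
    HasDerivAt (fourierA r) (fourierA (fun b => I * (b * r b)) β) β := by
  have hm : ∀ β : ℝ, Continuous fun b : ℝ => r b * cexp (I * b * β) := fun β => by fun_prop
  have hm' : Continuous fun b : ℝ => I * (b * r b) * cexp (I * b * β) := by fun_prop
  have hb : Integrable fun b : ℝ => ‖I * (b * r b)‖ := by
    refine Integrable.norm (Continuous.integrable_of_hasCompactSupport (by fun_prop) ?_)
    exact (hr.mul_left (f := fun b : ℝ => (b : ℂ))).mul_left (f := fun _ : ℝ => I)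
  refine (hasDerivAt_integral_of_dominated_loc_of_deriv_le (s := Set.univ) (x₀ := β)
    (F := fun (β b : ℝ) => r b * cexp (I * b * β))
    (F' := fun (β b : ℝ) => I * (b * r b) * cexp (I * b * β)) Filter.univ_mem
    (.of_forall fun β => (hm β).aestronglyMeasurable)
    ((hm β).integrable_of_hasCompactSupport hr.mul_right) hm'.aestronglyMeasurable
    (.of_forall fun b β _ => ?_) hb (.of_forall fun b β _ => ?_)).2
  · rw [norm_mul_cexp]
  · have h := (ofRealCLM.hasDerivAt (x := β)).const_mul (I * b)
    refine (h.cexp.const_mul (r b)).congr_deriv ?_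
    simp only [ofRealCLM_apply, ofReal_one, mul_one]
    ring

theorem integrable_of_norm_mul_le {F : ℝ → ℂ} (hF : AEStronglyMeasurable F) {C : ℝ}
    (hC : ∀ β, ‖F β‖ * (1 + β ^ 2) ≤ C) : Integrable F := by
  refine (integrable_inv_one_add_sq.const_mul C).mono' hF (.of_forall fun β => ?_)
  rw [← div_eq_mul_inv, le_div_iff₀ (by positivity)]
  exact hC β

/-- Fourier inversion at the origin. -/
theorem integral_fourierA (hc : Continuous r) (hi : Integrable r)
    (hF : Integrable (fourierA r)) : (1 / (2 * Real.pi)) * ∫ α, fourierA r α = r 0 := by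
  -- `𝓕` uses the character `e^{-2πi b w}`; the rescaling by `-2π` produces the factor `1 / (2π)`.
  have h1 : ∀ w : ℝ, 𝓕 r w = fourierA r (-(2 * Real.pi) * w) := by
    intro w
    rw [Real.fourier_eq']
    refine integral_congr_ae (.of_forall fun b => ?_)
    simp only [smul_eq_mul, RCLike.inner_apply, conj_trivial]
    rw [mul_comm]
    congr 2
    push_cast
    ring
  have h2 : 𝓕 r = fun w => fourierA r (-(2 * Real.pi) * w) := funext h1
  have h0 : -(2 * Real.pi) ≠ 0 := by simp [Real.pi_ne_zero]
  have h3 : Integrable (𝓕 r) := by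
    rw [h2]
    exact hF.comp_mul_left' h0
  have h4 := congrFun (hc.fourierInv_fourier_eq hi h3) 0
  rw [Real.fourierInv_eq', h2] at h4
  simp only [inner_zero_right, mul_zero, ofReal_zero, zero_mul, Complex.exp_zero, one_smul] at h4
  rw [Measure.integral_comp_mul_left] at h4
  rw [← h4, abs_inv, abs_neg, abs_of_pos (by positivity), Complex.real_smul]
  push_cast
  ring

end FourierOneVariable

/-! ### Partial Fourier transform of test functions on the plane -/

section PartialFourier

/-- Smooth compactly supported functions on the plane. -/
structure IsTest (h : ℝ × ℝ → ℂ) : Prop where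
  contDiff : ContDiff ℝ ∞ h
  hasCompactSupport : HasCompactSupport h

/-- The partial derivative `∂_a`. -/
def partialA (h : ℝ × ℝ → ℂ) (p : ℝ × ℝ) : ℂ := fderiv ℝ h p (1, 0)

/-- The partial derivative `∂_b`. -/
def partialB (h : ℝ × ℝ → ℂ) (p : ℝ × ℝ) : ℂ := fderiv ℝ h p (0, 1)

/-- The Fourier transform in the second variable. -/
def partialFourier (h : ℝ × ℝ → ℂ) (a β : ℝ) : ℂ := fourierA (fun b => h (a, b)) β

variable {h k : ℝ × ℝ → ℂ}

namespace IsTest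

theorem continuous (hh : IsTest h) : Continuous h := hh.contDiff.continuous

theorem partialA (hh : IsTest h) : IsTest (partialA h) :=
  ⟨(hh.contDiff.fderiv_right (m := ∞) le_rfl).clm_apply contDiff_const,
    hh.hasCompactSupport.fderiv_apply (𝕜 := ℝ) (1, 0)⟩

theorem partialB (hh : IsTest h) : IsTest (partialB h) :=
  ⟨(hh.contDiff.fderiv_right (m := ∞) le_rfl).clm_apply contDiff_const,
    hh.hasCompactSupport.fderiv_apply (𝕜 := ℝ) (0, 1)⟩

theorem add (hh : IsTest h) (hk : IsTest k) : IsTest (h + k) :=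
  ⟨hh.contDiff.add hk.contDiff, hh.hasCompactSupport.add hk.hasCompactSupport⟩

theorem hasDerivAt_left (hh : IsTest h) (a b : ℝ) :
    HasDerivAt (fun a => h (a, b)) (AffineGroup.partialA h (a, b)) a :=
  (hh.contDiff.differentiable (by simp) (a, b)).hasFDerivAt.comp_hasDerivAt a
    ((hasDerivAt_id a).prodMk (hasDerivAt_const a b))

theorem hasDerivAt_right (hh : IsTest h) (a b : ℝ) :
    HasDerivAt (fun b => h (a, b)) (AffineGroup.partialB h (a, b)) b :=
  (hh.contDiff.differentiable (by simp) (a, b)).hasFDerivAt.comp_hasDerivAt b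
    ((hasDerivAt_const b a).prodMk (hasDerivAt_id b))

/-- A radius outside of which a test function vanishes. -/
theorem exists_radius (hh : IsTest h) :
    ∃ R : ℝ, (∀ a b, R < |a| → h (a, b) = 0) ∧ ∀ a b, R < |b| → h (a, b) = 0 := by
  obtain ⟨R, hR⟩ := hh.hasCompactSupport.isCompact.isBounded.subset_closedBall 0
  have key : ∀ p : ℝ × ℝ, R < ‖p‖ → h p = 0 := by
    intro p hp
    by_contra hne
    have := hR (subset_tsupport h hne)
    rw [mem_closedBall_zero_iff] at this
    linarith
  exact ⟨R, fun a b hab => key _ (hab.trans_le (norm_fst_le (a, b))),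
    fun a b hab => key _ (hab.trans_le (norm_snd_le (a, b)))⟩

theorem hasCompactSupport_slice (hh : IsTest h) (a : ℝ) :
    HasCompactSupport fun b => h (a, b) := by
  obtain ⟨R, -, hR⟩ := hh.exists_radius
  refine HasCompactSupport.intro (isCompact_Icc (a := -R) (b := R)) fun b hb => hR a b ?_
  rw [Set.mem_Icc, ← abs_le] at hb
  exact not_le.1 hb

theorem continuous_slice (hh : IsTest h) (a : ℝ) : Continuous fun b => h (a, b) :=
  hh.continuous.comp (by fun_prop)

/-- A majorant in `b` uniform in `a`, for dominated convergence and for estimates uniform in `a`. -/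
theorem exists_bound (hh : IsTest h) :
    ∃ g : ℝ → ℝ, Integrable g ∧ ∀ a b, ‖h (a, b)‖ ≤ g b := by
  obtain ⟨R, -, hR⟩ := hh.exists_radius
  obtain ⟨C, hC⟩ := hh.hasCompactSupport.exists_bound_of_continuous hh.continuous
  refine ⟨(Set.Icc (-R) R).indicator fun _ => C, ?_, fun a b => ?_⟩
  · exact (integrable_indicator_iff measurableSet_Icc).2 (by simp)
  · by_cases hb : b ∈ Set.Icc (-R) R
    · rw [Set.indicator_of_mem hb]
      exact hC _
    · rw [Set.indicator_of_notMem hb]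
      rw [Set.mem_Icc, ← abs_le] at hb
      rw [hR a b (not_le.1 hb), norm_zero]

theorem partialFourier_partialB (hh : IsTest h) (a β : ℝ) :
    partialFourier (AffineGroup.partialB h) a β = -(I * β) * partialFourier h a β :=
  fourierA_of_hasDerivAt (hh.hasCompactSupport_slice a) (hh.hasDerivAt_right a)
    (hh.partialB.continuous_slice a) β

theorem partialFourier_add (hh : IsTest h) (hk : IsTest k) (a β : ℝ) :
    partialFourier (h + k) a β = partialFourier h a β + partialFourier k a β := by
  have hi : ∀ {h}, IsTest h → Integrable fun b : ℝ => h (a, b) * cexp (I * b * β) := fun hh =>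
    ((hh.continuous_slice a).mul (by fun_prop)).integrable_of_hasCompactSupport
      (hh.hasCompactSupport_slice a).mul_right
  unfold partialFourier fourierA
  rw [← integral_add (hi hh) (hi hk)]
  simp only [Pi.add_apply, add_mul]

/-- The partial Fourier transform decays quadratically, uniformly in the first variable. -/
theorem exists_partialFourier_bound (hh : IsTest h) :
    ∃ C, ∀ a β, ‖partialFourier h a β‖ * (1 + β ^ 2) ≤ C := by
  obtain ⟨g, hg, hgb⟩ := hh.exists_bound
  obtain ⟨g', hg', hgb'⟩ := hh.partialB.partialB.exists_bound
  refine ⟨(∫ b, g b) + ∫ b, g' b, fun a β => ?_⟩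
  refine (norm_fourierA_mul_le (hh.hasCompactSupport_slice a) (hh.hasDerivAt_right a)
    (hh.partialB.hasDerivAt_right a) (hh.partialB.partialB.continuous_slice a) β).trans ?_
  exact add_le_add
    (integral_mono_of_nonneg (.of_forall fun _ => norm_nonneg _) hg (.of_forall (hgb a)))
    (integral_mono_of_nonneg (.of_forall fun _ => norm_nonneg _) hg' (.of_forall (hgb' a)))

theorem exists_partialFourier_radius (hh : IsTest h) :
    ∃ R : ℝ, ∀ a β, R < |a| → partialFourier h a β = 0 := by
  obtain ⟨R, hR, -⟩ := hh.exists_radius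
  refine ⟨R, fun a β ha => ?_⟩
  simp only [partialFourier, fourierA, hR a _ ha, zero_mul, integral_zero]

theorem continuous_partialFourier (hh : IsTest h) :
    Continuous fun p : ℝ × ℝ => partialFourier h p.1 p.2 := by
  obtain ⟨g, hg, hgb⟩ := hh.exists_bound
  have hc := hh.continuous
  refine continuous_of_dominated (bound := g) (fun p => ?_) (fun p => .of_forall fun b => ?_) hg
    (.of_forall fun b => ?_)
  · exact Continuous.aestronglyMeasurable (by fun_prop)
  · rw [norm_mul_cexp]
    exact hgb _ _
  · fun_prop

theorem hasDerivAt_partialFourier (hh : IsTest h) (a β : ℝ) :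
    HasDerivAt (fun a => partialFourier h a β)
      (partialFourier (AffineGroup.partialA h) a β) a := by
  obtain ⟨g, hg, hgb⟩ := hh.partialA.exists_bound
  have hec : Continuous fun b : ℝ => cexp (I * b * β) := by fun_prop
  refine (hasDerivAt_integral_of_dominated_loc_of_deriv_le (s := Set.univ) (x₀ := a)
    (F := fun a b => h (a, b) * cexp (I * b * β))
    (F' := fun a b => AffineGroup.partialA h (a, b) * cexp (I * b * β)) Filter.univ_mem
    (.of_forall fun a => ((hh.continuous_slice a).mul hec).aestronglyMeasurable)
    (((hh.continuous_slice a).mul hec).integrable_of_hasCompactSupport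
      (hh.hasCompactSupport_slice a).mul_right)
    ((hh.partialA.continuous_slice a).mul hec).aestronglyMeasurable
    (.of_forall fun b a _ => ?_) hg (.of_forall fun b a _ => ?_)).2
  · rw [norm_mul_cexp]
    exact hgb _ _
  · exact (hh.hasDerivAt_left a b).mul_const _

theorem hasCompactSupport_partialFourier (hh : IsTest h) (β : ℝ) :
    HasCompactSupport fun a => partialFourier h a β := by
  obtain ⟨R, hR⟩ := hh.exists_partialFourier_radius
  refine HasCompactSupport.intro (isCompact_Icc (a := -R) (b := R)) fun a ha => hR a β ?_
  rw [Set.mem_Icc, ← abs_le] at ha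
  exact not_le.1 ha

theorem continuous_partialFourier_comp {X : Type*} [TopologicalSpace X] {u v : X → ℝ}
    (hh : IsTest h) (hu : Continuous u) (hv : Continuous v) :
    Continuous fun x => partialFourier h (u x) (v x) :=
  hh.continuous_partialFourier.comp (hu.prodMk hv)

theorem continuous_partialFourier_left (hh : IsTest h) (β : ℝ) :
    Continuous fun a => partialFourier h a β :=
  hh.continuous_partialFourier_comp continuous_id continuous_const

theorem continuous_partialFourier_right (hh : IsTest h) (a : ℝ) :
    Continuous fun β => partialFourier h a β :=
  hh.continuous_partialFourier_comp continuous_const continuous_id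

theorem integrable_partialFourier_right (hh : IsTest h) (a : ℝ) :
    Integrable fun β => partialFourier h a β := by
  obtain ⟨C, hC⟩ := hh.exists_partialFourier_bound
  exact integrable_of_norm_mul_le (hh.continuous_partialFourier_right a).aestronglyMeasurable
    (hC a)

end IsTest

end PartialFourier

/-! ### Exponential weights -/

theorem integrable_exp_neg_mul_abs {c : ℝ} (hc : 0 < c) :
    Integrable fun x : ℝ => Real.exp (-c * |x|) := by
  rw [← integrableOn_univ, ← Set.Iic_union_Ioi (a := (0 : ℝ))]
  refine IntegrableOn.union ?_ ?_
  · refine (integrableOn_exp_mul_Iic hc 0).congr_fun (fun x hx => ?_) measurableSet_Iic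
    simp only [abs_of_nonpos (Set.mem_Iic.1 hx), mul_neg, neg_mul, neg_neg]
  · refine (exp_neg_integrableOn_Ioi 0 hc).congr_fun (fun x hx => ?_) measurableSet_Ioi
    simp only [abs_of_pos (Set.mem_Ioi.1 hx)]

theorem memLp_exp_neg_mul_abs {c : ℝ} (hc : 0 < c) :
    MemLp (fun x : ℝ => Real.exp (-c * |x|)) 2 := by
  have hm : Continuous fun x : ℝ => Real.exp (-c * |x|) := by fun_prop
  rw [memLp_two_iff_integrable_sq hm.aestronglyMeasurable]
  refine (integrable_exp_neg_mul_abs (c := 2 * c) (by positivity)).congr (.of_forall fun x => ?_)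
  simp only [← Real.exp_nat_mul]
  congr 1
  push_cast
  ring

/-- With `|β| = e^{-s}` this reads `|β| ≤ e^{-|s|} (1 + β²)`: the quadratic decay in `β` pays for
the growth of `e^{-s}` at `-∞`. -/
theorem exp_neg_le_exp_neg_abs_mul (s : ℝ) :
    Real.exp (-s) ≤ Real.exp (-|s|) * (1 + Real.exp (-s) ^ 2) := by
  rcases le_total 0 s with hs | hs
  · rw [abs_of_nonneg hs]
    exact le_mul_of_one_le_right (Real.exp_pos _).le (by nlinarith [Real.exp_pos (-s)])
  · rw [abs_of_nonpos hs, neg_neg, ← Real.exp_nat_mul, mul_add, ← Real.exp_add]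
    have : s + (2 : ℕ) * -s = -s := by push_cast; ring
    rw [this]
    linarith [Real.exp_pos s]

/-! ### The derivation `δ₂`, the half-line integrals and `τ` -/

section Derivation

variable (f : SmoothAlgebra)

theorem isTest_haarDensity : IsTest (haarDensity f) :=
  ⟨(ofRealCLM.contDiff.comp (Real.contDiff_exp.comp contDiff_fst)).mul f.contDiff,
    hasCompactSupport_haarDensity f⟩

theorem tilde_eq_partialFourier (a β : ℝ) :
    tilde f a β = partialFourier (haarDensity f) a β := by
  simp only [tilde, partialFourier, fourierA, haarDensity, mul_assoc, integral_const_mul]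

/-- The function `-b e^a f(a, b)`, whose derivative in `b` is `e^a δ₂ f`. -/
def momentDensity (p : ℝ × ℝ) : ℂ := -((p.2 : ℂ) * haarDensity f p)

theorem isTest_momentDensity : IsTest (momentDensity f) :=
  ⟨((ofRealCLM.contDiff.comp contDiff_snd).mul (isTest_haarDensity f).contDiff).neg,
    (hasCompactSupport_haarDensity f).mul_left.neg⟩

theorem partialB_momentDensity : partialB (momentDensity f) = haarDensity (delta₂ f) := by
  funext ⟨a, b⟩
  have hf : HasDerivAt (fun b => f (a, b)) (fderiv ℝ f (a, b) (0, 1)) b :=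
    (f.contDiff.differentiable (by simp) (a, b)).hasFDerivAt.comp_hasDerivAt b
      ((hasDerivAt_const b a).prodMk (hasDerivAt_id b))
  have h1 : HasDerivAt (fun b : ℝ => -((b : ℂ) * (Real.exp a * f (a, b))))
      (-(1 * (Real.exp a * f (a, b)) + (b : ℂ) * (Real.exp a * fderiv ℝ f (a, b) (0, 1)))) b :=
    ((ofRealCLM.hasDerivAt (x := b)).mul (hf.const_mul _)).neg
  rw [((isTest_momentDensity f).hasDerivAt_right a b).unique h1]
  change _ = (Real.exp a : ℂ) * (-f (a, b) - (b : ℂ) * fderiv ℝ f (a, b) (0, 1))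
  ring

theorem tilde_delta₂ (a β : ℝ) :
    tilde (delta₂ f) a β = -(I * β) * partialFourier (momentDensity f) a β := by
  rw [tilde_eq_partialFourier, ← partialB_momentDensity,
    (isTest_momentDensity f).partialFourier_partialB]

/-- The derivative of `tilde f 0`. -/
theorem hasDerivAt_tilde_zero (β : ℝ) :
    HasDerivAt (tilde f 0) (-I * partialFourier (momentDensity f) 0 β) β := by
  have h0 : tilde f 0 = fourierA fun b => haarDensity f (0, b) :=
    funext fun β => tilde_eq_partialFourier f 0 β
  rw [h0]
  refine (hasDerivAt_fourierA ((isTest_haarDensity f).hasCompactSupport_slice 0)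
    ((isTest_haarDensity f).continuous_slice 0) β).congr_deriv ?_
  simp only [partialFourier, fourierA, momentDensity, ← integral_const_mul]
  refine integral_congr_ae (.of_forall fun b => ?_)
  ring

theorem integrable_tilde_zero : Integrable (tilde f 0) := by
  have h0 : tilde f 0 = fun β => partialFourier (haarDensity f) 0 β :=
    funext fun β => tilde_eq_partialFourier f 0 β
  rw [h0]
  exact (isTest_haarDensity f).integrable_partialFourier_right 0

theorem integrable_deriv_tilde_zero :
    Integrable fun β => -I * partialFourier (momentDensity f) 0 β :=
  ((isTest_momentDensity f).integrable_partialFourier_right 0).const_mul _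

/-- An integrable function with integrable derivative vanishes at infinity. -/
theorem tendsto_tilde_zero_atTop : Filter.Tendsto (tilde f 0) Filter.atTop (nhds 0) :=
  tendsto_zero_of_hasDerivAt_of_integrableOn_Ioi (a := 0) (fun β _ => hasDerivAt_tilde_zero f β)
    (integrable_deriv_tilde_zero f).integrableOn (integrable_tilde_zero f).integrableOn

theorem tendsto_tilde_zero_atBot : Filter.Tendsto (tilde f 0) Filter.atBot (nhds 0) :=
  tendsto_zero_of_hasDerivAt_of_integrableOn_Iic (a := 0) (fun β _ => hasDerivAt_tilde_zero f β)
    (integrable_deriv_tilde_zero f).integrableOn (integrable_tilde_zero f).integrableOn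

/-- The factor `β` in `tilde (δ₂ f)` cancels the pole, leaving the derivative of `tilde f 0`. -/
theorem inv_mul_tilde_delta₂ {β : ℝ} (hβ : β ≠ 0) :
    (β : ℂ)⁻¹ * tilde (delta₂ f) 0 β = -I * partialFourier (momentDensity f) 0 β := by
  have : (β : ℂ) ≠ 0 := ofReal_ne_zero.2 hβ
  rw [tilde_delta₂]
  field_simp

theorem integrableOn_inv_mul_tilde_delta₂ {s : Set ℝ} (hs : MeasurableSet s) (h0 : (0 : ℝ) ∉ s) :
    IntegrableOn (fun β : ℝ => (β : ℂ)⁻¹ * tilde (delta₂ f) 0 β) s :=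
  (integrable_deriv_tilde_zero f).integrableOn.congr_fun
    (fun _ hβ => (inv_mul_tilde_delta₂ f (ne_of_mem_of_not_mem hβ h0)).symm) hs

theorem integral_Iio_inv_mul_tilde_delta₂ :
    ∫ β in Set.Iio (0 : ℝ), (β : ℂ)⁻¹ * tilde (delta₂ f) 0 β = tilde f 0 0 := by
  rw [setIntegral_congr_fun measurableSet_Iio
      (fun β hβ => inv_mul_tilde_delta₂ f (ne_of_lt hβ)), ← integral_Iic_eq_integral_Iio,
    integral_Iic_of_hasDerivAt_of_tendsto
      (hasDerivAt_tilde_zero f 0).continuousAt.continuousWithinAt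
      (fun β _ => hasDerivAt_tilde_zero f β) (integrable_deriv_tilde_zero f).integrableOn
      (tendsto_tilde_zero_atBot f), sub_zero]

theorem integral_Ioi_inv_mul_tilde_delta₂ :
    ∫ β in Set.Ioi (0 : ℝ), (β : ℂ)⁻¹ * tilde (delta₂ f) 0 β = -tilde f 0 0 := by
  rw [setIntegral_congr_fun measurableSet_Ioi
      (fun β hβ => inv_mul_tilde_delta₂ f (ne_of_gt hβ)),
    integral_Ioi_of_hasDerivAt_of_tendsto
      (hasDerivAt_tilde_zero f 0).continuousAt.continuousWithinAt
      (fun β _ => hasDerivAt_tilde_zero f β) (integrable_deriv_tilde_zero f).integrableOn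
      (tendsto_tilde_zero_atTop f), zero_sub]

theorem rho_eq_partialFourier : rho f = fun a => partialFourier (haarDensity f) a 0 :=
  funext fun a => tilde_eq_partialFourier f a 0

/-- `ρ(f)` is twice continuously differentiable with compact support, so its transform decays
quadratically. -/
theorem integrable_fourierA_rho : Integrable (fourierA (rho f)) := by
  have hh := isTest_haarDensity f
  have hr := hh.hasCompactSupport_partialFourier 0
  have hrc := hh.continuous_partialFourier_left 0
  rw [rho_eq_partialFourier]
  refine integrable_of_norm_mul_le ?_ (norm_fourierA_mul_le hr
    (fun a => hh.hasDerivAt_partialFourier a 0)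
    (fun a => hh.partialA.hasDerivAt_partialFourier a 0)
    (hh.partialA.partialA.continuous_partialFourier_left 0))
  exact (continuous_iff_continuousAt.2 fun β =>
    (hasDerivAt_fourierA hr hrc β).continuousAt).aestronglyMeasurable

/-- Fourier inversion at `a = 0`, applied to `ρ(f)`. -/
theorem tau_eq_tilde : tau f = tilde f 0 0 := by
  have hh := isTest_haarDensity f
  have hF := integrable_fourierA_rho f
  rw [rho_eq_partialFourier] at hF
  have hrc := hh.continuous_partialFourier_left 0
  rw [tau, tilde_eq_partialFourier, rho_eq_partialFourier]
  exact integral_fourierA hrc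
    (hrc.integrable_of_hasCompactSupport (hh.hasCompactSupport_partialFourier 0)) hF

end Derivation

/-! ### Trace of `π_ν(δ₂ f)` -/

section Representation

variable (f : SmoothAlgebra) {ν : ℝ}

theorem norm_mul_exp_neg (hν : |ν| = 1) (s : ℝ) :
    ‖-(I * (ν * Real.exp (-s) : ℝ))‖ = Real.exp (-s) := by
  rw [norm_neg, norm_mul, norm_I, one_mul, Complex.norm_real, norm_mul, Real.norm_eq_abs, hν,
    one_mul, Real.norm_of_nonneg (Real.exp_pos _).le]

/-- The bound for `β h(a, β)` along `β = ν e^{-s}`. -/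
theorem norm_mul_partialFourier_le {h : ℝ × ℝ → ℂ} {C : ℝ}
    (hC : ∀ a β, ‖partialFourier h a β‖ * (1 + β ^ 2) ≤ C) (hν : |ν| = 1) (a s : ℝ) :
    ‖-(I * (ν * Real.exp (-s) : ℝ)) * partialFourier h a (ν * Real.exp (-s))‖ ≤
      C * Real.exp (-|s|) := by
  have h1 := hC a (ν * Real.exp (-s))
  rw [mul_pow, ← sq_abs ν, hν, one_pow, one_mul] at h1
  rw [norm_mul, norm_mul_exp_neg hν]
  calc Real.exp (-s) * ‖partialFourier h a (ν * Real.exp (-s))‖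
      ≤ Real.exp (-|s|) * (1 + Real.exp (-s) ^ 2) *
          ‖partialFourier h a (ν * Real.exp (-s))‖ := by
        gcongr
        exact exp_neg_le_exp_neg_abs_mul s
    _ = Real.exp (-|s|) * (‖partialFourier h a (ν * Real.exp (-s))‖ *
          (1 + Real.exp (-s) ^ 2)) := by ring
    _ ≤ Real.exp (-|s|) * C := by gcongr
    _ = _ := mul_comm _ _

/-- The integral of the kernel of `π_ν(δ₂ f)` over the diagonal. -/
theorem integral_tilde_delta₂_exp (hν : |ν| = 1) :
    ∫ s, tilde (delta₂ f) 0 (ν * Real.exp (-s)) = -tilde f 0 0 := by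
  have hk := isTest_momentDensity f
  obtain ⟨C, hC⟩ := hk.exists_partialFourier_bound
  have hc : Continuous fun s : ℝ => -(I * (ν * Real.exp (-s) : ℝ)) *
      partialFourier (momentDensity f) 0 (ν * Real.exp (-s)) := by
    refine Continuous.mul (by fun_prop) ?_
    exact (hk.continuous_partialFourier_right 0).comp
      (by fun_prop : Continuous fun s : ℝ => ν * Real.exp (-s))
  have hi : Integrable fun s : ℝ => -(I * (ν * Real.exp (-s) : ℝ)) *
      partialFourier (momentDensity f) 0 (ν * Real.exp (-s)) := by
    have h1 := (integrable_exp_neg_mul_abs one_pos).const_mul C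
    simp only [neg_mul, one_mul] at h1
    exact h1.mono' hc.aestronglyMeasurable
      (.of_forall fun s => norm_mul_partialFourier_le hC hν 0 s)
  -- The diagonal kernel is an exact derivative in `s`. Whatever the sign of `ν`, `s → +∞` is `β →
  -- 0`, so both signs give the same value.
  have hd : ∀ s : ℝ, HasDerivAt (fun s : ℝ => -tilde f 0 (ν * Real.exp (-s)))
      (-(I * (ν * Real.exp (-s) : ℝ)) *
        partialFourier (momentDensity f) 0 (ν * Real.exp (-s))) s := by
    intro s
    have h1 : HasDerivAt (fun s : ℝ => ν * Real.exp (-s)) (ν * (Real.exp (-s) * -1)) s :=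
      ((hasDerivAt_neg s).exp).const_mul ν
    have h2 := ((hasDerivAt_tilde_zero f (ν * Real.exp (-s))).scomp s h1).neg
    refine h2.congr_deriv ?_
    rw [Complex.real_smul]
    push_cast
    ring
  have htop : Filter.Tendsto (fun s : ℝ => -tilde f 0 (ν * Real.exp (-s))) Filter.atTop
      (nhds (-tilde f 0 0)) := by
    have h1 : Filter.Tendsto (fun s : ℝ => ν * Real.exp (-s)) Filter.atTop (nhds 0) := by
      simpa using (Real.tendsto_exp_neg_atTop_nhds_zero).const_mul ν
    exact ((hasDerivAt_tilde_zero f 0).continuousAt.tendsto.comp h1).neg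
  have hbot : Filter.Tendsto (fun s : ℝ => -tilde f 0 (ν * Real.exp (-s))) Filter.atBot
      (nhds 0) := by
    have h1 : Filter.Tendsto (fun s : ℝ => Real.exp (-s)) Filter.atBot Filter.atTop :=
      Real.tendsto_exp_atTop.comp Filter.tendsto_neg_atBot_atTop
    rw [← neg_zero (G := ℂ)]
    rcases eq_or_eq_neg_of_abs_eq hν with rfl | rfl
    · simp only [one_mul]
      exact ((tendsto_tilde_zero_atTop f).comp h1).neg
    · simp only [neg_mul, one_mul]
      exact ((tendsto_tilde_zero_atBot f).comp
        (Filter.tendsto_neg_atTop_atBot.comp h1)).neg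
  simp_rw [tilde_delta₂]
  rw [integral_of_hasDerivAt_of_tendsto hd hi hbot htop, sub_zero]

/-- The function `(1 + ∂_a) (-b e^a f)`. -/
def kernelDensity : ℝ × ℝ → ℂ := momentDensity f + partialA (momentDensity f)

theorem isTest_kernelDensity : IsTest (kernelDensity f) :=
  (isTest_momentDensity f).add (isTest_momentDensity f).partialA

/-- The integrating factor `e^{x - t}` turns `∂_a` into `1 + ∂_a`. -/
theorem hasDerivAt_exp_mul_tilde_delta₂ (s t β x : ℝ) :
    HasDerivAt (fun x : ℝ => (Real.exp (-(t - x)) : ℂ) * tilde (delta₂ f) (x - s) β)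
      (-(I * β) * partialFourier (kernelDensity f) (x - s) β * Real.exp (-(t - x))) x := by
  have hk := isTest_momentDensity f
  have h1 : HasDerivAt (fun x : ℝ => Real.exp (-(t - x))) (Real.exp (-(t - x))) x := by
    simpa using (((hasDerivAt_id x).const_sub t).neg).exp
  have h2 : HasDerivAt (fun x : ℝ => tilde (delta₂ f) (x - s) β)
      (-(I * β) * partialFourier (partialA (momentDensity f)) (x - s) β) x := by
    simp_rw [tilde_delta₂]
    exact (HasDerivAt.comp_sub_const x s (hk.hasDerivAt_partialFourier (x - s) β)).const_mul _
  refine (h1.ofReal_comp.mul h2).congr_deriv ?_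
  rw [kernelDensity, hk.partialFourier_add hk.partialA, tilde_delta₂]
  ring

/-- The kernel of `π_ν(δ₂ f)` factors through the convolution by `expWeight`. -/
theorem tilde_delta₂_eq_integral (s t β : ℝ) :
    tilde (delta₂ f) (t - s) β =
      ∫ x, -(I * β) * partialFourier (kernelDensity f) (x - s) β * expWeight (t - x) := by
  have hk := isTest_kernelDensity f
  obtain ⟨R, hR⟩ := (isTest_momentDensity f).exists_partialFourier_radius
  have hw : ∀ x, -(I * β) * partialFourier (kernelDensity f) (x - s) β * expWeight (t - x) =
      (Set.Iio t).indicator (fun x : ℝ =>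
        -(I * β) * partialFourier (kernelDensity f) (x - s) β * Real.exp (-(t - x))) x := by
    intro x
    unfold expWeight
    by_cases hx : x < t
    · rw [Set.indicator_of_mem (Set.mem_Ioi.2 (sub_pos.2 hx)),
        Set.indicator_of_mem (Set.mem_Iio.2 hx)]
    · have h1 : t - x ∉ Set.Ioi (0 : ℝ) := fun h => hx (sub_pos.1 h)
      have h2 : x ∉ Set.Iio t := hx
      rw [Set.indicator_of_notMem h1, Set.indicator_of_notMem h2, mul_zero]
  simp_rw [hw]
  have hi : Integrable fun x : ℝ =>
      -(I * β) * partialFourier (kernelDensity f) (x - s) β * Real.exp (-(t - x)) := by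
    refine Continuous.integrable_of_hasCompactSupport ?_ ?_
    · have := (hk.continuous_partialFourier_left β).comp
        (by fun_prop : Continuous fun x : ℝ => x - s)
      exact (continuous_const.mul this).mul (by fun_prop)
    · exact (((hk.hasCompactSupport_partialFourier β).comp_homeomorph
        (Homeomorph.subRight s)).mul_left (f := fun _ => -(I * β))).mul_right
  -- Compact support in `a` kills the boundary term at `-∞`; at `x = t` the exponential is `1`.
  have hlim : Filter.Tendsto
      (fun x : ℝ => (Real.exp (-(t - x)) : ℂ) * tilde (delta₂ f) (x - s) β)
      Filter.atBot (nhds 0) := by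
    refine tendsto_const_nhds.congr' ?_
    filter_upwards [Filter.eventually_lt_atBot (s - |R|)] with x hx
    have h1 : R < |x - s| := by
      rw [abs_of_neg (by linarith [abs_nonneg R])]
      linarith [le_abs_self R]
    rw [tilde_delta₂, hR _ _ h1, mul_zero, mul_zero]
  rw [integral_indicator measurableSet_Iio, ← integral_Iic_eq_integral_Iio,
    integral_Iic_of_hasDerivAt_of_tendsto
      (hasDerivAt_exp_mul_tilde_delta₂ f s t β t).continuousAt.continuousWithinAt
      (fun x _ => hasDerivAt_exp_mul_tilde_delta₂ f s t β x) hi.integrableOn hlim]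
  simp

theorem isTraceClass_and_hasTrace_rep_delta₂ (hν : |ν| = 1) :
    IsTraceClass (rep ν (delta₂ f)) ∧ HasTrace (rep ν (delta₂ f)) (-tau f) := by
  have hk := isTest_kernelDensity f
  obtain ⟨C, hC⟩ := hk.exists_partialFourier_bound
  obtain ⟨R, hR⟩ := hk.exists_partialFourier_radius
  have hC0 : 0 ≤ C := le_trans (by positivity) (hC 0 0)
  have hU : Continuous fun z : ℝ × ℝ => -(I * (ν * Real.exp (-z.2) : ℝ)) *
      partialFourier (kernelDensity f) (z.1 - z.2) (ν * Real.exp (-z.2)) := by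
    have h1 : Continuous fun z : ℝ × ℝ => -(I * (ν * Real.exp (-z.2) : ℝ)) := by fun_prop
    have h2 : Continuous fun z : ℝ × ℝ => ν * Real.exp (-z.2) := by fun_prop
    exact h1.mul (hk.continuous_partialFourier_comp (continuous_fst.sub continuous_snd) h2)
  have hb : ∀ x s : ℝ, ‖-(I * (ν * Real.exp (-s) : ℝ)) *
      partialFourier (kernelDensity f) (x - s) (ν * Real.exp (-s))‖ ≤
      (C * Real.exp (R / 2)) * Real.exp (-(1 / 2) * |x|) * Real.exp (-(1 / 2) * |s|) := by
    intro x s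
    by_cases hx : R < |x - s|
    · rw [hR _ _ hx, mul_zero, norm_zero]
      positivity
    · refine (norm_mul_partialFourier_le hC hν (x - s) s).trans ?_
      rw [mul_assoc, mul_assoc, ← Real.exp_add, ← Real.exp_add]
      gcongr
      -- From `|x| ≤ |s| + R`, half of the decay `e^{-|s|}` is traded for decay in `x`, at the cost
      -- of `e^{R/2}`.
      linarith [abs_sub_abs_le_abs_sub x s]
  have h := isTraceClass_and_hasTrace_of_kernel
    (U := fun x s => -(I * (ν * Real.exp (-s) : ℝ)) *
      partialFourier (kernelDensity f) (x - s) (ν * Real.exp (-s)))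
    (p := fun x => (C * Real.exp (R / 2)) * Real.exp (-(1 / 2) * |x|))
    (q := fun s => Real.exp (-(1 / 2) * |s|))
    (K := fun s t => tilde (delta₂ f) (t - s) (ν * Real.exp (-s))) hU.stronglyMeasurable
    (fun x => by positivity)
    ((integrable_exp_neg_mul_abs one_half_pos).const_mul _)
    (integrable_exp_neg_mul_abs one_half_pos) (memLp_exp_neg_mul_abs one_half_pos) hb
    (fun s t => tilde_delta₂_eq_integral f s t (ν * Real.exp (-s))) (inner_rep ν (delta₂ f))
  simp only [sub_self] at h
  rwa [integral_tilde_delta₂_exp f hν, ← tau_eq_tilde] at h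

end Representation

end AffineGroup

end

theorem mainTheorem9 (f : AffineGroup.SmoothAlgebra) :
    AffineGroup.IsTraceClass (AffineGroup.repMinus (AffineGroup.delta₂ f)) ∧
    AffineGroup.IsTraceClass (AffineGroup.repPlus (AffineGroup.delta₂ f)) ∧
    -- the integral defining `τ(f)` converges absolutely
    MeasureTheory.Integrable (AffineGroup.fourierA (AffineGroup.rho f)) ∧
    -- `τ(f) = - Tr π_-(δ₂ f) = - Tr π_+(δ₂ f)`
    AffineGroup.HasTrace (AffineGroup.repMinus (AffineGroup.delta₂ f)) (-AffineGroup.tau f) ∧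
    AffineGroup.HasTrace (AffineGroup.repPlus (AffineGroup.delta₂ f)) (-AffineGroup.tau f) ∧
    -- `τ(f) = ∫_{-∞}^0 (1/β) (δ₂ f)~(0, β) dβ = - ∫_0^∞ (1/β) (δ₂ f)~(0, β) dβ`
    MeasureTheory.IntegrableOn
      (fun β : ℝ => (β : ℂ)⁻¹ * AffineGroup.tilde (AffineGroup.delta₂ f) 0 β) (Set.Iio 0) ∧
    MeasureTheory.IntegrableOn
      (fun β : ℝ => (β : ℂ)⁻¹ * AffineGroup.tilde (AffineGroup.delta₂ f) 0 β) (Set.Ioi 0) ∧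
    AffineGroup.tau f =
      ∫ β in Set.Iio (0 : ℝ), (β : ℂ)⁻¹ * AffineGroup.tilde (AffineGroup.delta₂ f) 0 β ∧
    AffineGroup.tau f =
      -∫ β in Set.Ioi (0 : ℝ), (β : ℂ)⁻¹ * AffineGroup.tilde (AffineGroup.delta₂ f) 0 β := by
  obtain ⟨hm, hm'⟩ := AffineGroup.isTraceClass_and_hasTrace_rep_delta₂ f (ν := -1) (by simp)
  obtain ⟨hp, hp'⟩ := AffineGroup.isTraceClass_and_hasTrace_rep_delta₂ f (ν := 1) (by simp)
  refine ⟨hm, hp, AffineGroup.integrable_fourierA_rho f, hm', hp',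
    AffineGroup.integrableOn_inv_mul_tilde_delta₂ f measurableSet_Iio (by simp),
    AffineGroup.integrableOn_inv_mul_tilde_delta₂ f measurableSet_Ioi (by simp), ?_, ?_⟩
  · rw [AffineGroup.integral_Iio_inv_mul_tilde_delta₂, AffineGroup.tau_eq_tilde]
  · rw [AffineGroup.integral_Ioi_inv_mul_tilde_delta₂, AffineGroup.tau_eq_tilde, neg_neg]
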